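/- **The graphs.** Let $a,b,c$ be the automorphisms of the rooted ternary tree given by $a=(01)(\mathrm{id},\mathrm{id},a)$, $b=(02)(\mathrm{id},b,\mathrm{id})$, $c=(12)(c,\mathrm{id},\mathrm{id})$; thus on words over $\{0,1,2\}$ one has $a(0w)=1w$, $a(1w)=0w$, $a(2w)=2a(w)$, and similarly for $b$ (exchanging $0,2$, with $b(1w)=1b(w)$) and $c$ (exchanging $1,2$, with $c(0w)=0c(w)$). They generate the Hanoi Towers group $H^{(3)}$. Its $n$-th Schreier graph $\Sigma_n$ has as vertices the $3^n$ words of length $n$; two distinct words $u,v$ are joined by an edge if $s(u)=v$ for some $s\in\{a,b,c\}$, and this edge is labelled by $s$ (the label is unique; loops are removed). Give the edges labelled $a,b,c$ real weights denoted by the same letters $a,b,c$, and let \[T_n(a,b,c)=\sum_{t}\ \prod_{e\in E(t)}w(e)\] be the weighted generating function of the spanning trees, the sum being over all spanning trees $t$ of $\Sigma_n$. **The rational map.** Let $P=(P_1,\dots,P_9)$ be the rational map of $\mathbb R^9$ with \[P_i=x_i\ (i=1,2,3),\qquad P_i=\frac{N_i}{D}\ (i=4,5,6),\qquad P_i=x_i+\frac{N_i}{D}\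 (i=7,8,9),\] where $D,N_4,\dots,N_9$ are the following polynomials in $x_1,\dots,x_9$: \[\begin{aligned} D={}&x_7^2x_8^2x_9^2-x_3^2x_8^2x_9^2-x_4^2x_7x_8x_9^2-x_2^2x_7^2x_9^2+x_2^2x_3^2x_9^2\\ &\quad -x_5^2x_7x_8^2x_9+x_3^2x_6^2x_8x_9-x_6^2x_7^2x_8x_9+x_4^2x_5^2x_8x_9+x_4^2x_6^2x_7x_9\\ &\quad +x_2^2x_5^2x_7x_9-x_1^2x_7^2x_8^2+x_1^2x_3^2x_8^2+x_5^2x_6^2x_7x_8+x_1^2x_4^2x_7x_8\\ &\quad -2x_1x_2x_3x_4x_5x_6-x_1^2x_2^2x_3^2+x_1^2x_2^2x_7^2-x_4^2x_5^2x_6^2 \end{aligned}\] \[\begin{aligned} N_4={}&2x_2x_3x_4^2x_5x_6x_9+x_1x_4x_5^2x_7x_8^2-x_1x_4^3x_5^2x_8-x_1x_2^2x_4x_5^2x_7+x_2x_3x_4^3x_9^2\\ &\quad -x_1x_4^4x_5x_6-x_1^2x_2x_3x_4^3+x_1x_5x_6x_7^2x_8^2-x_1x_3^2x_5x_6x_8^2-x_1x_2^2x_5x_6x_7^2\\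 &\quad +x_1x_2^2x_3^2x_5x_6+x_2x_3x_4x_5^2x_6^2-x_1x_3^2x_4x_6^2x_8+x_1x_4x_6^2x_7^2x_8-x_1x_4^3x_6^2x_7 \end{aligned}\] \[\begin{aligned} N_5={}&x_1x_3x_5^3x_8^2-x_1x_2^2x_3x_5^3-x_2x_4x_5^4x_6+x_2x_4^2x_5x_7x_9^2-x_2x_4^2x_5^3x_9\\ &\quad +2x_1x_3x_4x_5^2x_6x_8-x_1^2x_2x_4^2x_5x_7+x_2x_5x_6^2x_7^2x_9-x_2x_3^2x_5x_6^2x_9-x_2x_5^3x_6^2x_7\\ &\quad +x_2x_4x_6x_7^2x_9^2-x_2x_3^2x_4x_6x_9^2-x_1^2x_2x_4x_6x_7^2+x_1x_3x_4^2x_5x_6^2+x_1^2x_2x_3^2x_4x_6 \end{aligned}\] \[\begin{aligned} N_6={}&x_3x_4x_5x_8^2x_9^2-x_2^2x_3x_4x_5x_9^2-x_1^2x_3x_4x_5x_8^2+x_1^2x_2^2x_3x_4x_5+x_1x_2x_4^2x_5^2x_6\\ &\quad +2x_1x_2x_4x_5x_6^2x_7+x_3x_5^2x_6x_8^2x_9-x_3x_5^2x_6^3x_8-x_2^2x_3x_5^2x_6x_9-x_1^2x_3x_4^2x_6x_8\\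 &\quad +x_3x_4^2x_6x_8x_9^2-x_3x_4^2x_6^3x_9-x_3x_4x_5x_6^4+x_1x_2x_6^3x_7^2-x_1x_2x_3^2x_6^3 \end{aligned}\] \[\begin{aligned} N_7={}&-x_5^2x_7^2x_8^2x_9+x_3^2x_5^2x_8^2x_9+x_2^2x_5^2x_7^2x_9-x_2^2x_3^2x_5^2x_9+x_5^4x_7x_8^2\\ &\quad -x_4^2x_5^4x_8-x_2^2x_5^4x_7-x_4^2x_7^2x_8x_9^2+2x_4^2x_5^2x_7x_8x_9+x_3^2x_4^2x_8x_9^2\\ &\quad +x_4^4x_7x_9^2-x_4^4x_5^2x_9-x_1^2x_3^2x_4^2x_8+x_1^2x_4^2x_7^2x_8-x_1^2x_4^4x_7\\ &\quad +2x_3^2x_4x_5x_6x_8x_9-2x_4x_5x_6x_7^2x_8x_9+2x_4^3x_5x_6x_7x_9+2x_4x_5^3x_6x_7x_8-2x_4^3x_5^3x_6\\ &\quad -2x_1x_2x_3x_4^2x_5^2 \end{aligned}\] \[\begin{aligned} N_8={}&-x_4^2x_6^4x_7-x_3^2x_6^4x_8-2x_4^3x_5x_6^3-x_4^4x_6^2x_9-x_1^2x_4^4x_8\\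 &\quad +x_4^4x_8x_9^2+x_2^2x_4^2x_7x_9^2+x_3^2x_6^2x_8^2x_9-x_2^2x_3^2x_6^2x_9+2x_4^2x_6^2x_7x_8x_9\\ &\quad -x_1^2x_2^2x_4^2x_7+x_1^2x_4^2x_7x_8^2-x_4^2x_7x_8^2x_9^2-2x_1x_2x_3x_4^2x_6^2+2x_4^3x_5x_6x_8x_9\\ &\quad -2x_4x_5x_6x_7x_8^2x_9+2x_4x_5x_6^3x_7x_8+2x_2^2x_4x_5x_6x_7x_9-x_6^2x_7^2x_8^2x_9+x_2^2x_6^2x_7^2x_9\\ &\quad +x_6^4x_7^2x_8 \end{aligned}\] \[\begin{aligned} N_9={}&x_5^4x_8^2x_9-x_2^2x_5^4x_9-x_5^4x_6^2x_8+x_1^2x_5^2x_7x_8^2-x_1^2x_2^2x_5^2x_7\\ &\quad -x_5^2x_7x_8^2x_9^2+x_2^2x_5^2x_7x_9^2+2x_5^2x_6^2x_7x_8x_9-2x_1x_2x_3x_5^2x_6^2+2x_4x_5^3x_6x_8x_9\\ &\quad -2x_4x_5^3x_6^3+2x_1^2x_4x_5x_6x_7x_8-2x_4x_5x_6x_7x_8x_9^2+2x_4x_5x_6^3x_7x_9-x_3^2x_6^4x_9\\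 &\quad -x_5^2x_6^4x_7+x_1^2x_6^2x_7^2x_8-x_1^2x_3^2x_6^2x_8-x_6^2x_7^2x_8x_9^2+x_3^2x_6^2x_8x_9^2\\ &\quad +x_6^4x_7^2x_9 \end{aligned}\] Let $P^{(k)}$ be the $k$-th iterate of $P$ ($P^{(0)}=\mathrm{id}$), put \[x^{(k)}=P^{(k)}(a,b,c,a,b,c,a+b+c,a+b+c,a+b+c),\qquad D^{(k)}=D(x^{(k)}).\] **The matrices.** For $m\ge 1$ let $I_m$ be the identity matrix of size $3^m$, with rows and columns indexed by the words of length $m$ in lexicographic order, let $I_m^0$ be $I_m$ with its first diagonal entry replaced by $0$, and put $\gamma\widetilde I_m=\gamma I_m^0+(a+b+c)(I_m-I_m^0)$. Let $a_m$ be the matrix whose entry at $(u,v)$ is $a$ if $a(u)=v$ and $0$ otherwise, and define $b_m,c_m$ similarly. For $k\ge2$ and $x\in\mathbb R^9$ with $D(x)\neq0$ let \[\Lambda_k(x)=\begin{pmatrix}P_7(x)\widetilde I_{k-1}-c_{k-1}&-P_4(x)I^0_{k-1}&-P_5(x)I^0_{k-1}\\-P_4(x)I^0_{k-1}&P_8(x)I_{k-1}-b_{k-1}&-P_6(x)I_{k-1}\\-P_5(x)I^0_{k-1}&-P_6(x)I_{k-1}&P_9(x)I_{k-1}-a_{k-1}\end{pmatrix}.\]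 **Theorem.** (i) If $a,b,c>0$, then $D^{(k)}$ is defined and $D^{(k)}\ne0$ for every $k\ge0$. (ii) Let $n\ge3$ and let $a,b,c$ be real numbers such that the right-hand side below is defined, that is, $a+b\neq0$ and $D^{(k)}\neq0$ for $0\le k\le n-3$ (by (i), this holds for all $a,b,c>0$). Then \[T_n(a,b,c)=\frac1{a+b}\ \prod_{k=0}^{n-3}\bigl(D^{(k)}\bigr)^{3^{\,n-k-2}}\cdot\det\Lambda_2\bigl(P^{(n-3)}(a,b,c,a,b,c,a+b+c,a+b+c,a+b+c)\bigr).\] -/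

import Mathlib

open Matrix

/-! ### The Hanoi Towers group and its Schreier graphs -/

/-- Vertices of the `n`-th level of the rooted ternary tree: words of length `n` over `{0,1,2}`. -/
abbrev HanoiWord (n : ℕ) : Type := Fin n → Fin 3

/-- The permutations of the first letter by the generators `a`, `b`, `c`, which are
indexed by `0`, `1`, `2`: `a` acts by `(01)`, `b` by `(02)`, `c` by `(12)`. -/
def hanoiPerm : Fin 3 → Equiv.Perm (Fin 3) :=
  ![Equiv.swap 0 1, Equiv.swap 0 2, Equiv.swap 1 2]

/-- The action of the three generators on words, given by the self-similar presentation
`a = (01)(id, id, a)`, `b = (02)(id, b, id)`, `c = (12)(c, id, id)`: the restriction of a generator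
`s` to the subtree at the letter `x` is `s` itself if `x` is fixed by the permutation of `s`,
and the identity otherwise. -/
def hanoiAct (s : Fin 3) : (n : ℕ) → HanoiWord n → HanoiWord n
  | 0, w => w
  | n + 1, w =>
    Fin.cons (hanoiPerm s (w 0))
      (if hanoiPerm s (w 0) = w 0 then hanoiAct s n (Fin.tail w) else Fin.tail w)

/-- The `n`-th Schreier graph of the Hanoi Towers group, without its loops: two distinct words
are adjacent if and only if one of the generators maps one to the other. -/
def hanoiSchreier (n : ℕ) : SimpleGraph (HanoiWord n) :=
  SimpleGraph.fromRel fun u v => ∃ s, hanoiAct s n u = v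

/-- The generators are involutions. -/
theorem hanoiAct_hanoiAct (n : ℕ) (s : Fin 3) (u : HanoiWord n) :
    hanoiAct s n (hanoiAct s n u) = u := by
  induction n with
  | zero => exact Subsingleton.elim _ _
  | succ n ih =>
    have key : ∀ s x : Fin 3, hanoiPerm s (hanoiPerm s x) = x := by decide
    by_cases hs : hanoiPerm s (u 0) = u 0
    · simp [hanoiAct, hs, ih]
    · have hs' : u 0 ≠ hanoiPerm s (u 0) := Ne.symm hs
      simp [hanoiAct, hs, hs', key]

/-- An edge of the Schreier graph carries only one label (so that there are no multiple edges). -/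
theorem hanoiAct_label_unique (n : ℕ) (s t : Fin 3) (u : HanoiWord n)
    (h : hanoiAct s n u = hanoiAct t n u) (hu : hanoiAct s n u ≠ u) : s = t := by
  induction n with
  | zero => exact absurd (Subsingleton.elim _ _) hu
  | succ n ih =>
    simp only [hanoiAct] at h hu
    obtain ⟨h0, h1⟩ := Fin.cons_injective2 h
    by_cases hs : hanoiPerm s (u 0) = u 0
    · have ht : hanoiPerm t (u 0) = u 0 := h0 ▸ hs
      rw [if_pos hs, if_pos ht] at h1
      refine ih (Fin.tail u) h1 fun e => hu ?_
      rw [if_pos hs, hs, e, Fin.cons_self_tail]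
    · have key : ∀ (x s t : Fin 3), hanoiPerm s x = hanoiPerm t x → hanoiPerm s x ≠ x → s = t := by
        decide
      exact key _ _ _ h0 hs

open Classical in
/-- The weight of an edge: the weight `w s` of its label `s`
(the sum has exactly one nonzero term `w s` when `e` is an edge of the graph, since the label `s`
of an edge is unique). -/
noncomputable def hanoiEdgeWeight (w : Fin 3 → ℝ) (n : ℕ) (e : Sym2 (HanoiWord n)) : ℝ :=
  ∑ s : Fin 3, if ∃ u, e = s(u, hanoiAct s n u) then w s else 0

open Classical in
/-- The weighted generating function `∑_T ∏_{e ∈ T} w(e)` of the spanning trees `T` of a finite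
graph `G`; a spanning tree is given by its set of edges. -/
noncomputable def spanningTreeGF {V : Type*} [Fintype V] (G : SimpleGraph V) (w : Sym2 V → ℝ) : ℝ :=
  ∑ F : Finset (Sym2 V) with
      ((F : Set (Sym2 V)) ⊆ G.edgeSet ∧ (SimpleGraph.fromEdgeSet (F : Set (Sym2 V))).IsTree),
    ∏ e ∈ F, w e

/-- `T_n(a,b,c)`: the weighted generating function of the spanning trees of the `n`-th Schreier
graph, where the edges labelled by the generators `a`, `b`, `c` have the weights `a`, `b`, `c`. -/
noncomputable def hanoiT (n : ℕ) (a b c : ℝ) : ℝ :=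
  spanningTreeGF (hanoiSchreier n) (hanoiEdgeWeight ![a, b, c] n)

/-! ### The rational map -/

/-- The common denominator `D` of the rational map. -/
def hanoiD (x₁ x₂ x₃ x₄ x₅ x₆ x₇ x₈ x₉ : ℝ) : ℝ :=
  x₇^2 * x₈^2 * x₉^2 - x₃^2 * x₈^2 * x₉^2 - x₄^2 * x₇ * x₈ * x₉^2 - x₂^2 * x₇^2 * x₉^2
    + x₂^2 * x₃^2 * x₉^2 - x₅^2 * x₇ * x₈^2 * x₉ + x₃^2 * x₆^2 * x₈ * x₉ - x₆^2 * x₇^2 * x₈ * x₉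
    + x₄^2 * x₅^2 * x₈ * x₉ + x₄^2 * x₆^2 * x₇ * x₉ + x₂^2 * x₅^2 * x₇ * x₉ - x₁^2 * x₇^2 * x₈^2
    + x₁^2 * x₃^2 * x₈^2 + x₅^2 * x₆^2 * x₇ * x₈ + x₁^2 * x₄^2 * x₇ * x₈
    - 2 * x₁ * x₂ * x₃ * x₄ * x₅ * x₆ - x₁^2 * x₂^2 * x₃^2 + x₁^2 * x₂^2 * x₇^2
    - x₄^2 * x₅^2 * x₆^2

/-- The numerator of `P_4`. -/
def hanoiN4 (x₁ x₂ x₃ x₄ x₅ x₆ x₇ x₈ x₉ : ℝ) : ℝ :=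
  2 * x₂ * x₃ * x₄^2 * x₅ * x₆ * x₉ + x₁ * x₄ * x₅^2 * x₇ * x₈^2 - x₁ * x₄^3 * x₅^2 * x₈
    - x₁ * x₂^2 * x₄ * x₅^2 * x₇ + x₂ * x₃ * x₄^3 * x₉^2 - x₁ * x₄^4 * x₅ * x₆
    - x₁^2 * x₂ * x₃ * x₄^3 + x₁ * x₅ * x₆ * x₇^2 * x₈^2 - x₁ * x₃^2 * x₅ * x₆ * x₈^2
    - x₁ * x₂^2 * x₅ * x₆ * x₇^2 + x₁ * x₂^2 * x₃^2 * x₅ * x₆ + x₂ * x₃ * x₄ * x₅^2 * x₆^2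
    - x₁ * x₃^2 * x₄ * x₆^2 * x₈ + x₁ * x₄ * x₆^2 * x₇^2 * x₈ - x₁ * x₄^3 * x₆^2 * x₇

/-- The numerator of `P_5`. -/
def hanoiN5 (x₁ x₂ x₃ x₄ x₅ x₆ x₇ x₈ x₉ : ℝ) : ℝ :=
  x₁ * x₃ * x₅^3 * x₈^2 - x₁ * x₂^2 * x₃ * x₅^3 - x₂ * x₄ * x₅^4 * x₆
    + x₂ * x₄^2 * x₅ * x₇ * x₉^2 - x₂ * x₄^2 * x₅^3 * x₉ + 2 * x₁ * x₃ * x₄ * x₅^2 * x₆ * x₈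
    - x₁^2 * x₂ * x₄^2 * x₅ * x₇ + x₂ * x₅ * x₆^2 * x₇^2 * x₉ - x₂ * x₃^2 * x₅ * x₆^2 * x₉
    - x₂ * x₅^3 * x₆^2 * x₇ + x₂ * x₄ * x₆ * x₇^2 * x₉^2 - x₂ * x₃^2 * x₄ * x₆ * x₉^2
    - x₁^2 * x₂ * x₄ * x₆ * x₇^2 + x₁ * x₃ * x₄^2 * x₅ * x₆^2 + x₁^2 * x₂ * x₃^2 * x₄ * x₆

/-- The numerator of `P_6`. -/
def hanoiN6 (x₁ x₂ x₃ x₄ x₅ x₆ x₇ x₈ x₉ : ℝ) : ℝ :=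
  x₃ * x₄ * x₅ * x₈^2 * x₉^2 - x₂^2 * x₃ * x₄ * x₅ * x₉^2 - x₁^2 * x₃ * x₄ * x₅ * x₈^2
    + x₁^2 * x₂^2 * x₃ * x₄ * x₅ + x₁ * x₂ * x₄^2 * x₅^2 * x₆
    + 2 * x₁ * x₂ * x₄ * x₅ * x₆^2 * x₇ + x₃ * x₅^2 * x₆ * x₈^2 * x₉ - x₃ * x₅^2 * x₆^3 * x₈
    - x₂^2 * x₃ * x₅^2 * x₆ * x₉ - x₁^2 * x₃ * x₄^2 * x₆ * x₈ + x₃ * x₄^2 * x₆ * x₈ * x₉^2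
    - x₃ * x₄^2 * x₆^3 * x₉ - x₃ * x₄ * x₅ * x₆^4 + x₁ * x₂ * x₆^3 * x₇^2
    - x₁ * x₂ * x₃^2 * x₆^3

/-- The numerator of `P_7(x) - x_7`. -/
def hanoiN7 (x₁ x₂ x₃ x₄ x₅ x₆ x₇ x₈ x₉ : ℝ) : ℝ :=
  -x₅^2 * x₇^2 * x₈^2 * x₉ + x₃^2 * x₅^2 * x₈^2 * x₉ + x₂^2 * x₅^2 * x₇^2 * x₉
    - x₂^2 * x₃^2 * x₅^2 * x₉ + x₅^4 * x₇ * x₈^2 - x₄^2 * x₅^4 * x₈ - x₂^2 * x₅^4 * x₇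
    - x₄^2 * x₇^2 * x₈ * x₉^2 + 2 * x₄^2 * x₅^2 * x₇ * x₈ * x₉ + x₃^2 * x₄^2 * x₈ * x₉^2
    + x₄^4 * x₇ * x₉^2 - x₄^4 * x₅^2 * x₉ - x₁^2 * x₃^2 * x₄^2 * x₈ + x₁^2 * x₄^2 * x₇^2 * x₈
    - x₁^2 * x₄^4 * x₇ + 2 * x₃^2 * x₄ * x₅ * x₆ * x₈ * x₉ - 2 * x₄ * x₅ * x₆ * x₇^2 * x₈ * x₉
    + 2 * x₄^3 * x₅ * x₆ * x₇ * x₉ + 2 * x₄ * x₅^3 * x₆ * x₇ * x₈ - 2 * x₄^3 * x₅^3 * x₆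
    - 2 * x₁ * x₂ * x₃ * x₄^2 * x₅^2

/-- The numerator of `P_8(x) - x_8`. -/
def hanoiN8 (x₁ x₂ x₃ x₄ x₅ x₆ x₇ x₈ x₉ : ℝ) : ℝ :=
  -x₄^2 * x₆^4 * x₇ - x₃^2 * x₆^4 * x₈ - 2 * x₄^3 * x₅ * x₆^3 - x₄^4 * x₆^2 * x₉
    - x₁^2 * x₄^4 * x₈ + x₄^4 * x₈ * x₉^2 + x₂^2 * x₄^2 * x₇ * x₉^2 + x₃^2 * x₆^2 * x₈^2 * x₉
    - x₂^2 * x₃^2 * x₆^2 * x₉ + 2 * x₄^2 * x₆^2 * x₇ * x₈ * x₉ - x₁^2 * x₂^2 * x₄^2 * x₇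
    + x₁^2 * x₄^2 * x₇ * x₈^2 - x₄^2 * x₇ * x₈^2 * x₉^2 - 2 * x₁ * x₂ * x₃ * x₄^2 * x₆^2
    + 2 * x₄^3 * x₅ * x₆ * x₈ * x₉ - 2 * x₄ * x₅ * x₆ * x₇ * x₈^2 * x₉
    + 2 * x₄ * x₅ * x₆^3 * x₇ * x₈ + 2 * x₂^2 * x₄ * x₅ * x₆ * x₇ * x₉ - x₆^2 * x₇^2 * x₈^2 * x₉
    + x₂^2 * x₆^2 * x₇^2 * x₉ + x₆^4 * x₇^2 * x₈

/-- The numerator of `P_9(x) - x_9`. -/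
def hanoiN9 (x₁ x₂ x₃ x₄ x₅ x₆ x₇ x₈ x₉ : ℝ) : ℝ :=
  x₅^4 * x₈^2 * x₉ - x₂^2 * x₅^4 * x₉ - x₅^4 * x₆^2 * x₈ + x₁^2 * x₅^2 * x₇ * x₈^2
    - x₁^2 * x₂^2 * x₅^2 * x₇ - x₅^2 * x₇ * x₈^2 * x₉^2 + x₂^2 * x₅^2 * x₇ * x₉^2
    + 2 * x₅^2 * x₆^2 * x₇ * x₈ * x₉ - 2 * x₁ * x₂ * x₃ * x₅^2 * x₆^2
    + 2 * x₄ * x₅^3 * x₆ * x₈ * x₉ - 2 * x₄ * x₅^3 * x₆^3 + 2 * x₁^2 * x₄ * x₅ * x₆ * x₇ * x₈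
    - 2 * x₄ * x₅ * x₆ * x₇ * x₈ * x₉^2 + 2 * x₄ * x₅ * x₆^3 * x₇ * x₉ - x₃^2 * x₆^4 * x₉
    - x₅^2 * x₆^4 * x₇ + x₁^2 * x₆^2 * x₇^2 * x₈ - x₁^2 * x₃^2 * x₆^2 * x₈
    - x₆^2 * x₇^2 * x₈ * x₉^2 + x₃^2 * x₆^2 * x₈ * x₉^2 + x₆^4 * x₇^2 * x₉

/-- The denominator `D`, as a function on `ℝ^9`. -/
def hanoiDen (x : Fin 9 → ℝ) : ℝ :=
  hanoiD (x 0) (x 1) (x 2) (x 3) (x 4) (x 5) (x 6) (x 7) (x 8)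

/-- The rational map `P` of `ℝ^9` (meaningful where `hanoiDen x ≠ 0`); the coordinates
`x_1, …, x_9` are `x 0, …, x 8`. -/
noncomputable def hanoiP (x : Fin 9 → ℝ) : Fin 9 → ℝ :=
  ![x 0, x 1, x 2,
    hanoiN4 (x 0) (x 1) (x 2) (x 3) (x 4) (x 5) (x 6) (x 7) (x 8) / hanoiDen x,
    hanoiN5 (x 0) (x 1) (x 2) (x 3) (x 4) (x 5) (x 6) (x 7) (x 8) / hanoiDen x,
    hanoiN6 (x 0) (x 1) (x 2) (x 3) (x 4) (x 5) (x 6) (x 7) (x 8) / hanoiDen x,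
    x 6 + hanoiN7 (x 0) (x 1) (x 2) (x 3) (x 4) (x 5) (x 6) (x 7) (x 8) / hanoiDen x,
    x 7 + hanoiN8 (x 0) (x 1) (x 2) (x 3) (x 4) (x 5) (x 6) (x 7) (x 8) / hanoiDen x,
    x 8 + hanoiN9 (x 0) (x 1) (x 2) (x 3) (x 4) (x 5) (x 6) (x 7) (x 8) / hanoiDen x]

/-- The starting point `(a, b, c, a, b, c, a+b+c, a+b+c, a+b+c)`. -/
def hanoiStart (a b c : ℝ) : Fin 9 → ℝ :=
  ![a, b, c, a, b, c, a + b + c, a + b + c, a + b + c]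

/-- `P^{(k)}(a, b, c, a, b, c, a+b+c, a+b+c, a+b+c)`, with `P^{(k)}` the `k`-th iterate of `P`. -/
noncomputable def hanoiOrbit (a b c : ℝ) (k : ℕ) : Fin 9 → ℝ :=
  hanoiP^[k] (hanoiStart a b c)

/-- `D^{(k)}`, the value of `D` at the `k`-th point of the orbit. -/
noncomputable def hanoiDIter (a b c : ℝ) (k : ℕ) : ℝ := hanoiDen (hanoiOrbit a b c k)

/-! ### The matrices `Λ_k(x)` -/

/-- The matrix `a_n`, `b_n` or `c_n` (for `s = 0, 1, 2`) of the action of a generator on the words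
of length `n`, multiplied by the weight `t` of the generator. -/
def hanoiGenMatrix (s : Fin 3) (t : ℝ) (n : ℕ) : Matrix (HanoiWord n) (HanoiWord n) ℝ :=
  Matrix.of fun u v => if hanoiAct s n u = v then t else 0

/-- The matrix `I_n^0`: the identity with the first diagonal entry (at the word `0^n`) replaced
by zero. -/
def hanoiI0 (n : ℕ) : Matrix (HanoiWord n) (HanoiWord n) ℝ :=
  Matrix.diagonal fun u => if u = 0 then 0 else 1

/-- The matrix `γ Ĩ_n = γ I_n^0 + (a+b+c)(I_n - I_n^0)`; here `σ = a+b+c`. -/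
def hanoiITilde (σ γ : ℝ) (n : ℕ) : Matrix (HanoiWord n) (HanoiWord n) ℝ :=
  γ • hanoiI0 n + σ • (1 - hanoiI0 n)

/-- The matrix `Λ_k(x)`, `k ≥ 1`, in its `3 × 3` block form with blocks indexed by the words of
length `k - 1`; its entries are built from `P(x)`, whose coordinates `P_4, …, P_9` are
`hanoiP x 3, …, hanoiP x 8`. -/
noncomputable def hanoiLambda (a b c : ℝ) (k : ℕ) (x : Fin 9 → ℝ) :
    Matrix (Fin 3 × HanoiWord (k - 1)) (Fin 3 × HanoiWord (k - 1)) ℝ :=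
  Matrix.comp (Fin 3) (Fin 3) (HanoiWord (k - 1)) (HanoiWord (k - 1)) ℝ
    !![hanoiITilde (a + b + c) (hanoiP x 6) (k - 1) - hanoiGenMatrix 2 c (k - 1),
        -(hanoiP x 3 • hanoiI0 (k - 1)),
        -(hanoiP x 4 • hanoiI0 (k - 1));
      -(hanoiP x 3 • hanoiI0 (k - 1)),
        hanoiP x 7 • (1 : Matrix (HanoiWord (k - 1)) (HanoiWord (k - 1)) ℝ)
          - hanoiGenMatrix 1 b (k - 1),
        -(hanoiP x 5 • (1 : Matrix (HanoiWord (k - 1)) (HanoiWord (k - 1)) ℝ));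
      -(hanoiP x 4 • hanoiI0 (k - 1)),
        -(hanoiP x 5 • (1 : Matrix (HanoiWord (k - 1)) (HanoiWord (k - 1)) ℝ)),
        hanoiP x 8 • (1 : Matrix (HanoiWord (k - 1)) (HanoiWord (k - 1)) ℝ)
          - hanoiGenMatrix 0 a (k - 1)]

/-! By the weighted matrix-tree theorem, `hanoiT` is the Laplacian determinant with the word `0...0`
deleted. Instead of deleting this vertex, `hanoiGamma` at the starting point decouples it. The
vertex is fixed by `c`, so its diagonal entry is (a+b+c) - c = a+b and the determinant is (a+b) T_n.

Group the vertices by their first two letters. A generator continues past the second letter only at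
the pairs 00, 11, 22, since it fixes the first letter only if it acts there as a transposition of
the other two in the block description. The six other pairs form a weighted hexagon over each
remaining word, and distinct hexagons are not joined. Eliminating all of them by a Schur complement
yields one factor D per hexagon and leaves a matrix of the same shape, one letter shorter, with
parameters P(x) (`det_hanoiGamma_succ`). Iterating n-2 times gives the product formula; since Λ_k(x)
has P(x) built in, the last matrix is Λ_2 at the (n-3)-rd iterate.

For positive weights, P preserves positivity and zero row sums, as Schur complements of Laplacians
do. Under these conditions D expands with positive coefficients only. -/

/-! ### The weighted matrix-tree theorem, by expansion over parent maps. -/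

/-- A map assigning to each vertex other than `r` a parent, such that every vertex is a descendant
of `r`; this is witnessed by a height which decreases from a vertex to its parent. -/
def IsParentMap {V : Type*} (r : V) (f : {v : V // v ≠ r} → V) : Prop :=
  ∃ h : V → ℕ, ∀ v, h (f v) < h v

/-- Take the vertices whose chain of ancestors never reaches `r`. If there were none, the number of
steps to reach `r` would be a height. -/
theorem exists_closed_of_not_isParentMap {V : Type*} {r : V} {f : {v : V // v ≠ r} → V}
    (hf : ¬ IsParentMap r f) :
    ∃ S : Set V, S.Nonempty ∧ r ∉ S ∧ ∀ v : {v : V // v ≠ r}, f v ∈ S ↔ (v : V) ∈ S := by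
  classical
  -- Extending `f` by making `r` its own parent allows iteration.
  let F : V → V := fun v => if h : v ≠ r then f ⟨v, h⟩ else r
  have hF : ∀ v : {v : V // v ≠ r}, F v = f v := fun v => by simp [F, v.2]
  refine ⟨{v | ∀ k, F^[k] v ≠ r}, ?_, fun h => h 0 rfl, fun v => ?_⟩
  · by_contra hS
    rw [Set.not_nonempty_iff_eq_empty] at hS
    have hS' : ∀ v, ∃ k, F^[k] v = r := fun v => by
      by_contra! h
      have : v ∈ {v | ∀ k, F^[k] v ≠ r} := h
      simp [hS] at this
    refine hf ⟨fun v => Nat.find (hS' v), fun v => ?_⟩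
    have h0 := Nat.find_spec (hS' v)
    obtain ⟨k, hk⟩ : ∃ k, Nat.find (hS' v) = k + 1 := by
      refine Nat.exists_eq_succ_of_ne_zero fun h => v.2 ?_
      simpa [h] using h0
    change Nat.find (hS' (f v)) < Nat.find (hS' v)
    rw [hk] at h0 ⊢
    rw [Function.iterate_succ_apply, hF] at h0
    exact Nat.lt_succ_of_le (Nat.find_min' _ h0)
  · constructor
    · rintro h (_ | k)
      · exact v.2
      · rw [Function.iterate_succ_apply, hF]
        exact h k
    · intro h k
      have := h (k + 1)
      rwa [Function.iterate_succ_apply, hF] at this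

-- For a parent map, ordering by height makes the matrix triangular with unit diagonal. Otherwise
-- the indicator of a nonempty closed set avoiding `r` lies in the kernel.
open Classical in
theorem det_one_sub_parent {V : Type*} [Fintype V] (r : V) (f : {v : V // v ≠ r} → V) :
    (Matrix.of fun v v' : {v : V // v ≠ r} =>
      ((if v = v' then 1 else 0) - (if f v = v' then 1 else 0) : ℝ)).det =
      if IsParentMap r f then 1 else 0 := by
  split_ifs with hf
  · obtain ⟨h, hh⟩ := hf
    have htri : (Matrix.of fun v v' : {v : V // v ≠ r} =>
        ((if v = v' then 1 else 0) - (if f v = v' then 1 else 0) : ℝ)).BlockTriangular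
        fun v => OrderDual.toDual (h v) := by
      intro v v' hlt
      have hlt : h v < h v' := hlt
      have h1 : v ≠ v' := by rintro rfl; exact lt_irrefl _ hlt
      have h2 : f v ≠ v' := fun e => by
        have := hh v
        rw [e] at this
        omega
      simp [h1, h2]
    rw [htri.det]
    refine Finset.prod_eq_one fun k _ => ?_
    rw [← Matrix.det_one (n := {v // OrderDual.toDual (h (v : {v : V // v ≠ r}).1) = k})]
    congr 1
    ext ⟨v, hv⟩ ⟨v', hv'⟩
    have hne : f v ≠ v' := fun e => by
      have := hh v
      rw [e] at this
      have e' : h v = h v' := OrderDual.toDual.injective (hv.trans hv'.symm)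
      omega
    simp [Matrix.toSquareBlock_def, Matrix.one_apply, hne]
  · obtain ⟨S, ⟨s, hs⟩, hr, hS⟩ := exists_closed_of_not_isParentMap hf
    refine Matrix.exists_mulVec_eq_zero_iff.1 ⟨fun v => if (v : V) ∈ S then 1 else 0, ?_, ?_⟩
    · have hsr : s ≠ r := fun e => hr (e ▸ hs)
      exact fun e => by simpa [hs] using congrFun e ⟨s, hsr⟩
    · ext v
      simp only [Matrix.mulVec, dotProduct, Matrix.of_apply, sub_mul, Finset.sum_sub_distrib,
        Pi.zero_apply]
      have h1 : ∑ x : {v : V // v ≠ r}, (if v = x then (1 : ℝ) else 0) *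
          (if (x : V) ∈ S then 1 else 0) = if (v : V) ∈ S then 1 else 0 := by
        rw [Finset.sum_eq_single v] <;> simp +contextual [eq_comm]
      have h2 : ∑ x : {v : V // v ≠ r}, (if f v = x then (1 : ℝ) else 0) *
          (if (x : V) ∈ S then 1 else 0) = if f v ∈ S then 1 else 0 := by
        by_cases hfr : f v = r
        · rw [hfr, if_neg hr]
          exact Finset.sum_eq_zero fun x _ => by simp [Ne.symm x.2]
        · rw [Finset.sum_eq_single ⟨f v, hfr⟩]
          · simp
          · intro x _ hx
            have : f v ≠ x := fun e => hx (Subtype.ext e.symm)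
            simp [this]
          · simp
      rw [h1, h2]
      simp [hS v]

open Classical in
/-- The edges joining the vertices to their parents. -/
noncomputable def parentEdges {V : Type*} [Fintype V] {r : V} (f : {v : V // v ≠ r} → V) :
    Finset (Sym2 V) :=
  Finset.univ.image fun v : {v : V // v ≠ r} => s(v.1, f v)

/-- Two vertices with the same edge would be each other's parents, contradicting the heights. -/
theorem IsParentMap.injective {V : Type*} {r : V} {f : {v : V // v ≠ r} → V}
    (hf : IsParentMap r f) : Function.Injective fun v : {v : V // v ≠ r} => s(v.1, f v) := by
  obtain ⟨h, hh⟩ := hf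
  intro u v e
  rcases Sym2.eq_iff.1 e with ⟨e, -⟩ | ⟨e, e'⟩
  · exact Subtype.ext e
  · have h1 := hh u
    have h2 := hh v
    rw [e'] at h1
    rw [← e] at h2
    omega

theorem IsParentMap.ne {V : Type*} {r : V} {f : {v : V // v ≠ r} → V}
    (hf : IsParentMap r f) (v : {v : V // v ≠ r}) : (v : V) ≠ f v := by
  obtain ⟨h, hh⟩ := hf
  intro e
  have := hh v
  rw [← e] at this
  exact lt_irrefl _ this

theorem IsParentMap.card_parentEdges {V : Type*} [Fintype V] {r : V} {f : {v : V // v ≠ r} → V}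
    (hf : IsParentMap r f) : (parentEdges f).card + 1 = Fintype.card V := by
  classical
  rw [parentEdges, Finset.card_image_of_injective _ hf.injective, Finset.card_univ,
    Fintype.card_subtype_compl, Fintype.card_subtype_eq]
  have : 0 < Fintype.card V := Fintype.card_pos_iff.2 ⟨r⟩
  omega

/-- Following parents reaches `r`, so the graph is connected, and it has one edge fewer than
vertices. -/
theorem IsParentMap.isTree {V : Type*} [Fintype V] {r : V} {f : {v : V // v ≠ r} → V}
    (hf : IsParentMap r f) :
    (SimpleGraph.fromEdgeSet (parentEdges f : Set (Sym2 V))).IsTree := by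
  classical
  rw [SimpleGraph.isTree_iff_connected_and_card]
  constructor
  · have hr : ∀ n v, hf.choose v ≤ n →
        (SimpleGraph.fromEdgeSet (parentEdges f : Set (Sym2 V))).Reachable v r := by
      intro n
      induction n with
      | zero =>
        intro v hv
        by_cases hvr : v = r
        · rw [hvr]
        · have := hf.choose_spec ⟨v, hvr⟩
          simp only at this
          omega
      | succ n ih =>
        intro v hv
        by_cases hvr : v = r
        · rw [hvr]
        · have := hf.choose_spec ⟨v, hvr⟩
          simp only at this
          refine SimpleGraph.Reachable.trans (SimpleGraph.Adj.reachable ?_)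
            (ih (f ⟨v, hvr⟩) (by omega))
          rw [SimpleGraph.fromEdgeSet_adj]
          exact ⟨Finset.mem_coe.2 (Finset.mem_image_of_mem (fun v : {v : V // v ≠ r} => s(v.1, f v))
            (Finset.mem_univ (⟨v, hvr⟩ : {v : V // v ≠ r}))), hf.ne ⟨v, hvr⟩⟩
    have : Nonempty V := ⟨r⟩
    exact ⟨fun u v => (hr _ u le_rfl).trans (hr _ v le_rfl).symm⟩
  · have : (SimpleGraph.fromEdgeSet (parentEdges f : Set (Sym2 V))).edgeSet = parentEdges f := by
      rw [SimpleGraph.edgeSet_fromEdgeSet, sdiff_eq_left, Set.disjoint_left]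
      intro e he
      obtain ⟨v, -, rfl⟩ := Finset.mem_image.1 (Finset.mem_coe.1 he)
      simpa using hf.ne v
    rw [this, Nat.card_eq_fintype_card (α := V), ← hf.card_parentEdges]
    simp

/-- Induction on the height for `f`: if `g` used the edge from `v` to `f v` in the opposite
direction, then `v` would be the `g`-parent of `f v`, hence by induction its `f`-parent, which is
too high. -/
theorem IsParentMap.eq_of_parentEdges_eq {V : Type*} [Fintype V] {r : V}
    {f g : {v : V // v ≠ r} → V} (hf : IsParentMap r f)
    (h : parentEdges f = parentEdges g) : f = g := by
  classical
  have key : ∀ n, ∀ v : {v : V // v ≠ r}, hf.choose v ≤ n → f v = g v := by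
    intro n
    induction n with
    | zero =>
      intro v hv
      have := hf.choose_spec v
      omega
    | succ n ih =>
      intro v hv
      have hmem : s(v.1, f v) ∈ parentEdges g :=
        h ▸ Finset.mem_image_of_mem (fun v : {v : V // v ≠ r} => s(v.1, f v)) (Finset.mem_univ v)
      obtain ⟨u, -, hu⟩ := Finset.mem_image.1 hmem
      rcases Sym2.eq_iff.1 hu with ⟨e, e'⟩ | ⟨e, e'⟩
      · rw [← e', Subtype.ext e]
      · exfalso
        have h1 := hf.choose_spec v
        rw [← e] at h1
        have h2 := ih u (by omega)
        have h3 := hf.choose_spec u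
        rw [h2, e'] at h3
        omega
  exact funext fun v => key _ v le_rfl

/-- The parent is the next vertex on a shortest path to `r`, with the distance to `r` as height. -/
theorem exists_isParentMap_of_isTree {V : Type*} [Fintype V] (r : V) {F : Finset (Sym2 V)}
    (hF : ∀ e ∈ F, ¬ e.IsDiag) (hT : (SimpleGraph.fromEdgeSet (F : Set (Sym2 V))).IsTree) :
    ∃ f : {v : V // v ≠ r} → V, IsParentMap r f ∧ parentEdges f = F := by
  classical
  set T := SimpleGraph.fromEdgeSet (F : Set (Sym2 V)) with hTdef
  have hex : ∀ v : {v : V // v ≠ r}, ∃ u, T.Adj v u ∧ T.dist u r < T.dist v r := by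
    rintro ⟨v, hv⟩
    obtain ⟨p, hp⟩ := hT.1.exists_walk_length_eq_dist v r
    cases p with
    | nil => exact absurd rfl hv
    | cons hadj q =>
      refine ⟨_, hadj, ?_⟩
      have := SimpleGraph.dist_le q
      rw [SimpleGraph.Walk.length_cons] at hp
      simp only
      omega
  choose f hadj hlt using hex
  have hf : IsParentMap r f := ⟨fun v => T.dist v r, hlt⟩
  -- Both edge sets have one element fewer than there are vertices, so one inclusion suffices.
  refine ⟨f, hf, Finset.eq_of_subset_of_card_le ?_ ?_⟩
  · intro e he
    obtain ⟨v, -, rfl⟩ := Finset.mem_image.1 he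
    exact Finset.mem_coe.1 ((SimpleGraph.fromEdgeSet_adj _).1 (hadj v)).1
  · have h1 := hf.card_parentEdges
    have h2 := (SimpleGraph.isTree_iff_connected_and_card.1 hT).2
    have : T.edgeSet = F := by
      rw [hTdef, SimpleGraph.edgeSet_fromEdgeSet, sdiff_eq_left, Set.disjoint_left]
      exact fun e he => hF e (Finset.mem_coe.1 he)
    rw [this, Nat.card_eq_fintype_card (α := V), ← h1] at h2
    simp at h2
    omega

open Classical in
/-- The weighted matrix-tree theorem: the generating function of the spanning trees is the
determinant of the Laplacian matrix with the row and the column of a vertex `r` removed. -/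
theorem spanningTreeGF_eq_det {V : Type*} [Fintype V] (G : SimpleGraph V) (w : Sym2 V → ℝ)
    (hw : ∀ u v, u ≠ v → ¬ G.Adj u v → w s(u, v) = 0) (r : V) :
    spanningTreeGF G w = (Matrix.of fun v v' : {v : V // v ≠ r} =>
      ∑ u, w s((v : V), u) * ((if v = v' then 1 else 0) - (if u = v' then 1 else 0))).det := by
  have hdet : (Matrix.of fun v v' : {v : V // v ≠ r} =>
      ∑ u, w s((v : V), u) * ((if v = v' then 1 else 0) - (if u = v' then 1 else 0))).det =
      ∑ f : {v : V // v ≠ r} → V, (∏ v : {v : V // v ≠ r}, w s(v.1, f v)) *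
        if IsParentMap r f then 1 else 0 := by
    -- Each row is a weighted sum over the possible parents `u`; multilinearity in the rows turns
    -- the determinant into a sum over all maps `f`.
    have hrow : (Matrix.of fun v v' : {v : V // v ≠ r} =>
        ∑ u, w s((v : V), u) * ((if v = v' then (1 : ℝ) else 0) - (if u = v' then 1 else 0))) =
        fun v : {v : V // v ≠ r} => ∑ u, w s((v : V), u) •
          fun v' : {v : V // v ≠ r} => (if v = v' then (1 : ℝ) else 0) - (if u = v' then 1 else 0) := by
      ext v v'
      simp
    rw [hrow]
    change (Matrix.detRowAlternating (R := ℝ)).toMultilinearMap _ = _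
    rw [MultilinearMap.map_sum]
    refine Finset.sum_congr rfl fun f _ => ?_
    rw [MultilinearMap.map_smul_univ, smul_eq_mul, ← det_one_sub_parent r f]
    rfl
  rw [hdet, spanningTreeGF]
  have hfil : ∑ f : {v : V // v ≠ r} → V, (∏ v, w s(v.1, f v)) *
      (if IsParentMap r f then 1 else 0) =
      ∑ f : {v : V // v ≠ r} → V with IsParentMap r f ∧ ∀ v : {v : V // v ≠ r}, G.Adj v (f v),
        ∏ v : {v : V // v ≠ r}, w s(v.1, f v) := by
    rw [Finset.sum_filter]
    refine Finset.sum_congr rfl fun f _ => ?_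
    by_cases hf : IsParentMap r f
    · by_cases hG : ∀ v : {v : V // v ≠ r}, G.Adj v (f v)
      · simp only [hf, hG, implies_true, and_self, if_true, mul_one]
      · rw [if_neg (c := IsParentMap r f ∧ ∀ v : {v : V // v ≠ r}, G.Adj v (f v)) fun h => hG h.2]
        push Not at hG
        obtain ⟨v, hv⟩ := hG
        rw [Finset.prod_eq_zero (Finset.mem_univ v) (hw _ _ (hf.ne v) hv), zero_mul]
    · simp [hf]
  rw [hfil]
  symm
  -- The index set in `spanningTreeGF` elaborates to a finset of sets, the image of all finsets
  -- under coercion; this describes its members.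
  have hmem : ∀ F : Set (Sym2 V),
      (F ∈ (do let a ← (Finset.univ : Finset (Finset (Sym2 V))); pure (a : Set (Sym2 V)))) ↔
        ∃ a : Finset (Sym2 V), F = a := fun F => by
    simp [eq_comm]
  refine Finset.sum_bij (fun f _ => (parentEdges f : Set (Sym2 V))) ?_ ?_ ?_ ?_
  · intro f hf
    obtain ⟨hf, hG⟩ := (Finset.mem_filter.1 hf).2
    refine Finset.mem_filter.2 ⟨(hmem _).2 ⟨_, rfl⟩, ?_, hf.isTree⟩
    intro e he
    obtain ⟨v, -, rfl⟩ := Finset.mem_image.1 (Finset.mem_coe.1 he)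
    exact hG v
  · intro f hf g hg h
    exact (Finset.mem_filter.1 hf).2.1.eq_of_parentEdges_eq (Finset.coe_injective h)
  · intro F hF
    obtain ⟨hF, hsub, hT⟩ := Finset.mem_filter.1 hF
    obtain ⟨F, rfl⟩ := (hmem _).1 hF
    obtain ⟨f, hf, rfl⟩ := exists_isParentMap_of_isTree r
      (fun e he => G.not_isDiag_of_mem_edgeSet (hsub (Finset.mem_coe.2 he))) hT
    refine ⟨f, Finset.mem_filter.2 ⟨Finset.mem_univ _, hf, fun v => ?_⟩, rfl⟩
    exact hsub (Finset.mem_coe.2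
      (Finset.mem_image_of_mem (fun v => s(v.1, f v)) (Finset.mem_univ v)))
  · intro f hf
    rw [Finset.toFinset_coe, parentEdges,
      Finset.prod_image (Finset.mem_filter.1 hf).2.1.injective.injOn]

/-- Version of `spanningTreeGF_eq_det` for given decidability instances. -/
theorem spanningTreeGF_eq_det' {V : Type*} [Fintype V] [DecidableEq V] (G : SimpleGraph V)
    (w : Sym2 V → ℝ) (hw : ∀ u v, u ≠ v → ¬ G.Adj u v → w s(u, v) = 0) (r : V) :
    spanningTreeGF G w = (Matrix.of fun v v' : {v : V // v ≠ r} =>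
      ∑ u, w s((v : V), u) * ((if v = v' then 1 else 0) - (if u = v' then 1 else 0))).det := by
  rw [spanningTreeGF_eq_det G w hw r]
  convert rfl

/-! ### Determinant and adjugate of a weighted hexagon. -/

section SixCycle

variable (d0 d1 d2 d3 d4 d5 e0 e1 e2 e3 e4 e5 : ℝ)

/-- The symmetric matrix of a weighted hexagon with weights `e` and diagonal entries `d`. -/
def hexMatrix : Matrix (Fin 6) (Fin 6) ℝ :=
  !![d0, -e0, 0, 0, 0, -e5;
      -e0, d1, -e1, 0, 0, 0;
      0, -e1, d2, -e2, 0, 0;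
      0, 0, -e2, d3, -e3, 0;
      0, 0, 0, -e3, d4, -e4;
      -e5, 0, 0, 0, -e4, d5]

/-- The determinant of `hexMatrix`. -/
def hexDet : ℝ :=
  d0 * (d1 * (d2 * (d3 * (d4 * d5 - e4 ^ 2) - e3 ^ 2 * d5) - e2 ^ 2 * (d4 * d5 - e4 ^ 2)) - e1 ^ 2 * (d3 * (d4 * d5 - e4 ^ 2) - e3 ^ 2 * d5)) - e0 ^ 2 * (d2 * (d3 * (d4 * d5 - e4 ^ 2) - e3 ^ 2 * d5) - e2 ^ 2 * (d4 * d5 - e4 ^ 2))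
      - e5 ^ 2 * (d1 * (d2 * (d3 * d4 - e3 ^ 2) - e2 ^ 2 * d4) - e1 ^ 2 * (d3 * d4 - e3 ^ 2)) - 2 * (e0 * e1 * e2 * e3 * e4 * e5)

/-- The adjugate of `hexMatrix`; an entry is the sum over the two arcs of the hexagon that join
two vertices. -/
def hexAdj : Matrix (Fin 6) (Fin 6) ℝ :=
  !![d1 * (d2 * (d3 * (d4 * d5 - e4 ^ 2) - e3 ^ 2 * d5) - e2 ^ 2 * (d4 * d5 - e4 ^ 2)) - e1 ^ 2 * (d3 * (d4 * d5 - e4 ^ 2) - e3 ^ 2 * d5),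
        e0 * (d2 * (d3 * (d4 * d5 - e4 ^ 2) - e3 ^ 2 * d5) - e2 ^ 2 * (d4 * d5 - e4 ^ 2)) + e1 * e2 * e3 * e4 * e5,
        e0 * e1 * (d3 * (d4 * d5 - e4 ^ 2) - e3 ^ 2 * d5) + e2 * e3 * e4 * e5 * d1,
        e0 * e1 * e2 * (d4 * d5 - e4 ^ 2) + e3 * e4 * e5 * (d1 * d2 - e1 ^ 2),
        e0 * e1 * e2 * e3 * d5 + e4 * e5 * (d1 * (d2 * d3 - e2 ^ 2) - e1 ^ 2 * d3),
        e0 * e1 * e2 * e3 * e4 + e5 * (d1 * (d2 * (d3 * d4 - e3 ^ 2) - e2 ^ 2 * d4) - e1 ^ 2 * (d3 * d4 - e3 ^ 2));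
      e0 * (d2 * (d3 * (d4 * d5 - e4 ^ 2) - e3 ^ 2 * d5) - e2 ^ 2 * (d4 * d5 - e4 ^ 2)) + e1 * e2 * e3 * e4 * e5,
        d2 * (d3 * (d4 * (d5 * d0 - e5 ^ 2) - e4 ^ 2 * d0) - e3 ^ 2 * (d5 * d0 - e5 ^ 2)) - e2 ^ 2 * (d4 * (d5 * d0 - e5 ^ 2) - e4 ^ 2 * d0),
        e1 * (d3 * (d4 * (d5 * d0 - e5 ^ 2) - e4 ^ 2 * d0) - e3 ^ 2 * (d5 * d0 - e5 ^ 2)) + e2 * e3 * e4 * e5 * e0,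
        e1 * e2 * (d4 * (d5 * d0 - e5 ^ 2) - e4 ^ 2 * d0) + e3 * e4 * e5 * e0 * d2,
        e1 * e2 * e3 * (d5 * d0 - e5 ^ 2) + e4 * e5 * e0 * (d2 * d3 - e2 ^ 2),
        e1 * e2 * e3 * e4 * d0 + e5 * e0 * (d2 * (d3 * d4 - e3 ^ 2) - e2 ^ 2 * d4);
      e0 * e1 * (d3 * (d4 * d5 - e4 ^ 2) - e3 ^ 2 * d5) + e2 * e3 * e4 * e5 * d1,
        e1 * (d3 * (d4 * (d5 * d0 - e5 ^ 2) - e4 ^ 2 * d0) - e3 ^ 2 * (d5 * d0 - e5 ^ 2)) + e2 * e3 * e4 * e5 * e0,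
        d3 * (d4 * (d5 * (d0 * d1 - e0 ^ 2) - e5 ^ 2 * d1) - e4 ^ 2 * (d0 * d1 - e0 ^ 2)) - e3 ^ 2 * (d5 * (d0 * d1 - e0 ^ 2) - e5 ^ 2 * d1),
        e2 * (d4 * (d5 * (d0 * d1 - e0 ^ 2) - e5 ^ 2 * d1) - e4 ^ 2 * (d0 * d1 - e0 ^ 2)) + e3 * e4 * e5 * e0 * e1,
        e2 * e3 * (d5 * (d0 * d1 - e0 ^ 2) - e5 ^ 2 * d1) + e4 * e5 * e0 * e1 * d3,
        e2 * e3 * e4 * (d0 * d1 - e0 ^ 2) + e5 * e0 * e1 * (d3 * d4 - e3 ^ 2);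
      e0 * e1 * e2 * (d4 * d5 - e4 ^ 2) + e3 * e4 * e5 * (d1 * d2 - e1 ^ 2),
        e1 * e2 * (d4 * (d5 * d0 - e5 ^ 2) - e4 ^ 2 * d0) + e3 * e4 * e5 * e0 * d2,
        e2 * (d4 * (d5 * (d0 * d1 - e0 ^ 2) - e5 ^ 2 * d1) - e4 ^ 2 * (d0 * d1 - e0 ^ 2)) + e3 * e4 * e5 * e0 * e1,
        d4 * (d5 * (d0 * (d1 * d2 - e1 ^ 2) - e0 ^ 2 * d2) - e5 ^ 2 * (d1 * d2 - e1 ^ 2)) - e4 ^ 2 * (d0 * (d1 * d2 - e1 ^ 2) - e0 ^ 2 * d2),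
        e3 * (d5 * (d0 * (d1 * d2 - e1 ^ 2) - e0 ^ 2 * d2) - e5 ^ 2 * (d1 * d2 - e1 ^ 2)) + e4 * e5 * e0 * e1 * e2,
        e3 * e4 * (d0 * (d1 * d2 - e1 ^ 2) - e0 ^ 2 * d2) + e5 * e0 * e1 * e2 * d4;
      e0 * e1 * e2 * e3 * d5 + e4 * e5 * (d1 * (d2 * d3 - e2 ^ 2) - e1 ^ 2 * d3),
        e1 * e2 * e3 * (d5 * d0 - e5 ^ 2) + e4 * e5 * e0 * (d2 * d3 - e2 ^ 2),
        e2 * e3 * (d5 * (d0 * d1 - e0 ^ 2) - e5 ^ 2 * d1) + e4 * e5 * e0 * e1 * d3,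
        e3 * (d5 * (d0 * (d1 * d2 - e1 ^ 2) - e0 ^ 2 * d2) - e5 ^ 2 * (d1 * d2 - e1 ^ 2)) + e4 * e5 * e0 * e1 * e2,
        d5 * (d0 * (d1 * (d2 * d3 - e2 ^ 2) - e1 ^ 2 * d3) - e0 ^ 2 * (d2 * d3 - e2 ^ 2)) - e5 ^ 2 * (d1 * (d2 * d3 - e2 ^ 2) - e1 ^ 2 * d3),
        e4 * (d0 * (d1 * (d2 * d3 - e2 ^ 2) - e1 ^ 2 * d3) - e0 ^ 2 * (d2 * d3 - e2 ^ 2)) + e5 * e0 * e1 * e2 * e3;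
      e0 * e1 * e2 * e3 * e4 + e5 * (d1 * (d2 * (d3 * d4 - e3 ^ 2) - e2 ^ 2 * d4) - e1 ^ 2 * (d3 * d4 - e3 ^ 2)),
        e1 * e2 * e3 * e4 * d0 + e5 * e0 * (d2 * (d3 * d4 - e3 ^ 2) - e2 ^ 2 * d4),
        e2 * e3 * e4 * (d0 * d1 - e0 ^ 2) + e5 * e0 * e1 * (d3 * d4 - e3 ^ 2),
        e3 * e4 * (d0 * (d1 * d2 - e1 ^ 2) - e0 ^ 2 * d2) + e5 * e0 * e1 * e2 * d4,
        e4 * (d0 * (d1 * (d2 * d3 - e2 ^ 2) - e1 ^ 2 * d3) - e0 ^ 2 * (d2 * d3 - e2 ^ 2)) + e5 * e0 * e1 * e2 * e3,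
        d0 * (d1 * (d2 * (d3 * d4 - e3 ^ 2) - e2 ^ 2 * d4) - e1 ^ 2 * (d3 * d4 - e3 ^ 2)) - e0 ^ 2 * (d2 * (d3 * d4 - e3 ^ 2) - e2 ^ 2 * d4)]

theorem hexMatrix_mul_hexAdj :
    hexMatrix d0 d1 d2 d3 d4 d5 e0 e1 e2 e3 e4 e5 * hexAdj d0 d1 d2 d3 d4 d5 e0 e1 e2 e3 e4 e5 =
      hexDet d0 d1 d2 d3 d4 d5 e0 e1 e2 e3 e4 e5 • 1 := by
  ext i j
  fin_cases i <;> fin_cases j <;>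
    simp [hexMatrix, hexAdj, hexDet, Matrix.mul_apply, Fin.sum_univ_succ] <;> ring

theorem det_hexMatrix :
    (hexMatrix d0 d1 d2 d3 d4 d5 e0 e1 e2 e3 e4 e5).det =
      hexDet d0 d1 d2 d3 d4 d5 e0 e1 e2 e3 e4 e5 := by
  simp [hexMatrix, hexDet, Matrix.det_succ_row_zero, Fin.sum_univ_succ, Fin.succAbove]
  ring

end SixCycle

/-! ### The elimination step: from words of length m+1 to words of length m. -/

/-- A Schur complement taken separately over each index `u`. Writing the upper right block as `K u *
X u` avoids inverses; `G`, which mixes the indices, sits only in the corner that survives. -/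
theorem det_fromBlocks_blockDiagonal {m n o R : Type*} [Fintype m] [DecidableEq m] [Fintype n]
    [DecidableEq n] [Fintype o] [DecidableEq o] [CommRing R] (K : o → Matrix m m R)
    (X : o → Matrix m n R) (C : o → Matrix n m R) (S : o → Matrix n n R)
    (G : Matrix (n × o) (n × o) R) :
    (Matrix.fromBlocks (blockDiagonal K) (blockDiagonal fun u => K u * X u) (blockDiagonal C)
      (blockDiagonal S - G)).det =
      (∏ u, (K u).det) * (blockDiagonal (fun u => S u - C u * X u) - G).det := by
  have h : Matrix.fromBlocks (blockDiagonal K) (blockDiagonal fun u => K u * X u)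
      (blockDiagonal C) (blockDiagonal S - G) =
      Matrix.fromBlocks (blockDiagonal K) 0 (blockDiagonal C)
        (blockDiagonal (fun u => S u - C u * X u) - G) *
      Matrix.fromBlocks 1 (blockDiagonal X) 0 1 := by
    rw [Matrix.fromBlocks_multiply]
    have hS : blockDiagonal (fun u => S u - C u * X u) =
        blockDiagonal S - blockDiagonal fun u => C u * X u := blockDiagonal_sub S _
    simp only [Matrix.mul_one, Matrix.mul_zero, add_zero, hS, blockDiagonal_mul]
    congr 1
    rw [add_sub_assoc', add_sub_cancel]
  rw [h, det_mul, det_fromBlocks_zero₁₂, det_fromBlocks_zero₂₁, det_blockDiagonal]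
  simp

/-- The scalar part of the block form of the Hanoi matrices. If `z` is true, the first vertex is
decoupled from the others and carries the weight `σ`. -/
def hanoiQ (σ : ℝ) (x : Fin 9 → ℝ) : Bool → Matrix (Fin 3) (Fin 3) ℝ
  | false => !![x 6, -x 3, -x 4; -x 3, x 7, -x 5; -x 4, -x 5, x 8]
  | true => !![σ, 0, 0; 0, x 7, -x 5; 0, -x 5, x 8]

/-- The generator that fixes the letter `i`. -/
def hanoiLabel : Fin 3 → Fin 3 := ![2, 1, 0]

/-- The part of the block form of the Hanoi matrices that comes from the generators. -/
def hanoiG (a b c : ℝ) (m : ℕ) : Matrix (Fin 3 × HanoiWord m) (Fin 3 × HanoiWord m) ℝ :=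
  Matrix.of fun p q =>
    if p.1 = q.1 then hanoiGenMatrix (hanoiLabel p.1) (![c, b, a] p.1) m p.2 q.2 else 0

/-- The matrix obtained from the definition of `Λ` by putting `x` instead of `P(x)`. -/
def hanoiGamma (a b c : ℝ) (m : ℕ) (x : Fin 9 → ℝ) :
    Matrix (Fin 3 × HanoiWord m) (Fin 3 × HanoiWord m) ℝ :=
  blockDiagonal (fun u => hanoiQ (a + b + c) x (decide (u = 0))) - hanoiG a b c m

theorem hanoiLambda_eq_hanoiGamma (a b c : ℝ) (k : ℕ) (x : Fin 9 → ℝ) :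
    hanoiLambda a b c k x = hanoiGamma a b c (k - 1) (hanoiP x) := by
  ext ⟨i, u⟩ ⟨j, v⟩
  rw [hanoiLambda, Matrix.comp_apply]
  rcases eq_or_ne u v with rfl | huv
  · by_cases hu : u = 0 <;> fin_cases i <;> fin_cases j <;>
      simp only [Fin.zero_eta, Fin.mk_one, Fin.reduceFinMk, Matrix.of_apply, Matrix.cons_val] <;>
      simp [hanoiGamma, hanoiG, hanoiLabel, hanoiQ, hanoiITilde, hanoiI0, blockDiagonal_apply, hu]
  · fin_cases i <;> fin_cases j <;>
      simp only [Fin.zero_eta, Fin.mk_one, Fin.reduceFinMk, Matrix.of_apply, Matrix.cons_val] <;>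
      simp [hanoiGamma, hanoiG, hanoiLabel, hanoiITilde, hanoiI0, blockDiagonal_apply, huv]

/-- The scalar matrix obtained by splitting off one more letter. -/
def hanoiTwoLetter (σ : ℝ) (x : Fin 9 → ℝ) (z : Bool) : Matrix (Fin 3 × Fin 3) (Fin 3 × Fin 3) ℝ :=
  Matrix.of fun p q =>
    (if p.2 = q.2 then hanoiQ σ x (decide (p.2 = 0) && z) p.1 q.1 else 0) -
      (if p.1 = q.1 ∧ p.2 ≠ p.1 ∧ hanoiPerm (hanoiLabel p.1) p.2 = q.2 then ![x 2, x 1, x 0] p.1 else 0)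

theorem hanoiPerm_hanoiLabel_eq_self_iff : ∀ i p : Fin 3, hanoiPerm (hanoiLabel i) p = p ↔ p = i := by
  decide

/-- In block `i` the generator fixes only the letter `i`. Hence it acts on the rest of the word only
at the pair (i, i), and elsewhere it merely exchanges two letters, a scalar coupling. -/
theorem hanoiGamma_succ_apply (a b c : ℝ) (m : ℕ) (x : Fin 9 → ℝ) (h0 : x 0 = a) (h1 : x 1 = b)
    (h2 : x 2 = c) (i j p q : Fin 3) (u v : HanoiWord m) :
    hanoiGamma a b c (m + 1) x (i, Fin.cons p u) (j, Fin.cons q v) =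
      (if u = v then hanoiTwoLetter (a + b + c) x (decide (u = 0)) (i, p) (j, q) else 0) -
        (if i = p ∧ j = q then hanoiG a b c m (i, u) (j, v) else 0) := by
  have hz : (Fin.cons p u : HanoiWord (m + 1)) = 0 ↔ p = 0 ∧ u = 0 := by
    constructor
    · intro h
      exact ⟨congrFun h 0, funext fun k => congrFun h k.succ⟩
    · rintro ⟨rfl, rfl⟩
      exact funext fun k => Fin.cases rfl (fun _ => rfl) k
  have hz' : decide ((Fin.cons p u : HanoiWord (m + 1)) = 0) =
      (decide (p = 0) && decide (u = 0)) := by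
    rw [← Bool.decide_and, decide_eq_decide.2 hz]
  have ht : ![c, b, a] i = ![x 2, x 1, x 0] i := by rw [h0, h1, h2]
  simp only [hanoiGamma, hanoiTwoLetter, hanoiG, hanoiGenMatrix, Matrix.sub_apply, blockDiagonal_apply,
    Matrix.of_apply, hz', hanoiAct, Fin.cons_zero, Fin.tail_cons, Fin.cons_inj,
    hanoiPerm_hanoiLabel_eq_self_iff, ht]
  by_cases hij : i = j
  · subst hij
    by_cases hp : p = i
    · subst hp
      by_cases hq : p = q <;> by_cases huv : u = v <;>
        simp [hq, huv, (hanoiPerm_hanoiLabel_eq_self_iff _ _).2]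
    · have hpi : i ≠ p := Ne.symm hp
      rcases eq_or_ne p q with rfl | hq <;> by_cases huv : u = v <;>
        simp [hanoiPerm_hanoiLabel_eq_self_iff, *]
  · by_cases hq : p = q <;> by_cases huv : u = v <;> simp [hij, hq, huv]

/-- The words of length two: first the six words with distinct letters, in the order of the
hexagon which they form, then the three words `00`, `11`, `22`. -/
def hexEquiv : Fin 6 ⊕ Fin 3 ≃ Fin 3 × Fin 3 where
  toFun := Sum.elim ![(0, 1), (2, 1), (2, 0), (1, 0), (1, 2), (0, 2)] ![(0, 0), (1, 1), (2, 2)]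
  invFun p := ![![.inr 0, .inl 0, .inl 5], ![.inl 3, .inr 1, .inl 4], ![.inl 2, .inl 1, .inr 2]]
    p.1 p.2
  left_inv := by decide
  right_inv := by decide

theorem hexEquiv_inl : ∀ i, (hexEquiv (.inl i)).1 ≠ (hexEquiv (.inl i)).2 := by decide

theorem hexEquiv_inr : ∀ i, hexEquiv (.inr i) = (i, i) := by decide

/-- Splitting off the first letter after the block index. -/
def hanoiSplit (m : ℕ) : (Fin 6 × HanoiWord m) ⊕ (Fin 3 × HanoiWord m) ≃
    Fin 3 × HanoiWord (m + 1) :=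
  ((Equiv.sumProdDistrib _ _ _).symm.trans (hexEquiv.prodCongr (Equiv.refl _))).trans
    ((Equiv.prodAssoc _ _ _).trans
      ((Equiv.refl _).prodCongr (Fin.consEquiv fun _ : Fin (m + 1) => Fin 3)))

theorem hanoiSplit_inl (m : ℕ) (i : Fin 6) (u : HanoiWord m) :
    hanoiSplit m (.inl (i, u)) = ((hexEquiv (.inl i)).1, Fin.cons (hexEquiv (.inl i)).2 u) := rfl

theorem hanoiSplit_inr (m : ℕ) (i : Fin 3) (u : HanoiWord m) :
    hanoiSplit m (.inr (i, u)) = (i, Fin.cons i u) := by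
  change ((hexEquiv (.inr i)).1, (Fin.cons (hexEquiv (.inr i)).2 u : HanoiWord (m + 1))) = _
  rw [hexEquiv_inr]

/-- The hexagon eliminated in one step of the recursion. -/
def hanoiHex (x : Fin 9 → ℝ) : Matrix (Fin 6) (Fin 6) ℝ :=
  hexMatrix (x 6) (x 8) (x 8) (x 7) (x 7) (x 6) (x 4) (x 0) (x 5) (x 1) (x 3) (x 2)

/-- The adjugate of `hanoiHex`. -/
def hanoiHexAdj (x : Fin 9 → ℝ) : Matrix (Fin 6) (Fin 6) ℝ :=
  hexAdj (x 6) (x 8) (x 8) (x 7) (x 7) (x 6) (x 4) (x 0) (x 5) (x 1) (x 3) (x 2)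

theorem hexDet_hanoi (x : Fin 9 → ℝ) :
    hexDet (x 6) (x 8) (x 8) (x 7) (x 7) (x 6) (x 4) (x 0) (x 5) (x 1) (x 3) (x 2) =
      hanoiDen x := by
  unfold hexDet hanoiDen hanoiD
  ring

theorem det_hanoiHex (x : Fin 9 → ℝ) : (hanoiHex x).det = hanoiDen x := by
  rw [hanoiHex, det_hexMatrix, hexDet_hanoi]

theorem hanoiHex_mul_hanoiHexAdj (x : Fin 9 → ℝ) :
    hanoiHex x * hanoiHexAdj x = hanoiDen x • 1 := by
  rw [hanoiHex, hanoiHexAdj, hexMatrix_mul_hexAdj, hexDet_hanoi]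

/-- The decoupling encoded by `z` affects only the row and column of the pair (0, 0), outside the
hexagon, so all hexagons are equal. -/
theorem hanoiTwoLetter_inl_inl (σ : ℝ) (x : Fin 9 → ℝ) (z : Bool) :
    (Matrix.of fun i j => hanoiTwoLetter σ x z (hexEquiv (.inl i)) (hexEquiv (.inl j))) = hanoiHex x := by
  ext i j
  cases z <;> fin_cases i <;> fin_cases j <;>
    simp [hanoiTwoLetter, hanoiLabel, hexEquiv, hanoiHex, hexMatrix, hanoiQ, hanoiPerm]

/-- The coupling of the hexagon to the three remaining vertices. -/
def hanoiCoupling (x : Fin 9 → ℝ) : Bool → Matrix (Fin 6) (Fin 3) ℝ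
  | false => !![0, -x 3, 0; 0, -x 5, 0; -x 4, 0, 0; -x 3, 0, 0; 0, 0, -x 5; 0, 0, -x 4]
  | true => !![0, -x 3, 0; 0, -x 5, 0; 0, 0, 0; 0, 0, 0; 0, 0, -x 5; 0, 0, -x 4]

theorem hanoiTwoLetter_inl_inr (σ : ℝ) (x : Fin 9 → ℝ) (z : Bool) (i : Fin 6) (j : Fin 3) :
    hanoiTwoLetter σ x z (hexEquiv (.inl i)) (j, j) = hanoiCoupling x z i j := by
  cases z <;> fin_cases i <;> fin_cases j <;>
    simp [hanoiTwoLetter, hanoiLabel, hexEquiv, hanoiCoupling, hanoiQ, hanoiPerm]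

theorem hanoiTwoLetter_inr_inl (σ : ℝ) (x : Fin 9 → ℝ) (z : Bool) (i : Fin 3) (j : Fin 6) :
    hanoiTwoLetter σ x z (i, i) (hexEquiv (.inl j)) = hanoiCoupling x z j i := by
  cases z <;> fin_cases i <;> fin_cases j <;>
    simp [hanoiTwoLetter, hanoiLabel, hexEquiv, hanoiCoupling, hanoiQ, hanoiPerm, Equiv.swap_apply_def]

/-- The diagonal of `hanoiQ`. -/
def hanoiCore (σ : ℝ) (x : Fin 9 → ℝ) : Bool → Matrix (Fin 3) (Fin 3) ℝ
  | false => Matrix.diagonal ![x 6, x 7, x 8]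
  | true => Matrix.diagonal ![σ, x 7, x 8]

theorem hanoiTwoLetter_inr_inr (σ : ℝ) (x : Fin 9 → ℝ) (z : Bool) (i j : Fin 3) :
    hanoiTwoLetter σ x z (i, i) (j, j) = hanoiCore σ x z i j := by
  cases z <;> fin_cases i <;> fin_cases j <;>
    simp [hanoiTwoLetter, hanoiCore, hanoiQ]

/-- This is where the rational map comes from: its coordinates are the entries of the Schur
complement of the hexagon. For `z = true` the first column of the coupling vanishes, so the
decoupled vertex keeps its weight `σ`. -/
theorem coupling_elimination (σ : ℝ) (x : Fin 9 → ℝ) (hx : hanoiDen x ≠ 0) (z : Bool) :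
    hanoiCore σ x z - (hanoiCoupling x z)ᵀ *
      ((hanoiDen x)⁻¹ • (hanoiHexAdj x * hanoiCoupling x z)) = hanoiQ σ (hanoiP x) z := by
  ext i j
  cases z <;> fin_cases i <;> fin_cases j <;>
    simp [hanoiCore, hanoiCoupling, hanoiQ, hanoiP, Matrix.mul_apply, Fin.sum_univ_succ,
      hanoiHexAdj, hexAdj] <;>
    field_simp <;>
    simp only [hanoiDen, hanoiD, hanoiN4, hanoiN5, hanoiN6, hanoiN7, hanoiN8, hanoiN9] <;>
    ring

/-- There is one hexagon for each of the 3^m words `u`, whence the exponent; the generator part left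
over is again that of `hanoiGamma`. -/
theorem det_hanoiGamma_succ (a b c : ℝ) (m : ℕ) (x : Fin 9 → ℝ) (h0 : x 0 = a) (h1 : x 1 = b)
    (h2 : x 2 = c) (hx : hanoiDen x ≠ 0) :
    (hanoiGamma a b c (m + 1) x).det =
      hanoiDen x ^ 3 ^ m * (hanoiGamma a b c m (hanoiP x)).det := by
  rw [← Matrix.det_submatrix_equiv_self (hanoiSplit m)]
  have h : (hanoiGamma a b c (m + 1) x).submatrix (hanoiSplit m) (hanoiSplit m) =
      Matrix.fromBlocks (blockDiagonal fun _ => hanoiHex x)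
        (blockDiagonal fun u => hanoiHex x *
          ((hanoiDen x)⁻¹ • (hanoiHexAdj x * hanoiCoupling x (decide (u = 0)))))
        (blockDiagonal fun u => (hanoiCoupling x (decide (u = 0)))ᵀ)
        (blockDiagonal (fun u => hanoiCore (a + b + c) x (decide (u = 0))) - hanoiG a b c m) := by
    -- Brings the coupling into the form `K u * X u` by means of the explicit inverse of the
    -- hexagon.
    have hX : ∀ z, hanoiHex x * ((hanoiDen x)⁻¹ • (hanoiHexAdj x * hanoiCoupling x z)) =
        hanoiCoupling x z := fun z => by
      rw [Matrix.mul_smul, ← Matrix.mul_assoc, hanoiHex_mul_hanoiHexAdj, Matrix.smul_mul,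
        Matrix.one_mul, smul_smul, inv_mul_cancel₀ hx, one_smul]
    simp only [hX]
    ext (⟨i, u⟩ | ⟨i, u⟩) (⟨j, v⟩ | ⟨j, v⟩)
    · rw [Matrix.submatrix_apply, hanoiSplit_inl, hanoiSplit_inl,
        hanoiGamma_succ_apply a b c m x h0 h1 h2]
      simp [hexEquiv_inl i, blockDiagonal_apply, ← hanoiTwoLetter_inl_inl (a + b + c) x (decide (u = 0))]
    · rw [Matrix.submatrix_apply, hanoiSplit_inl, hanoiSplit_inr,
        hanoiGamma_succ_apply a b c m x h0 h1 h2]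
      simp [hexEquiv_inl i, blockDiagonal_apply, ← hanoiTwoLetter_inl_inr (a + b + c)]
    · rw [Matrix.submatrix_apply, hanoiSplit_inl, hanoiSplit_inr,
        hanoiGamma_succ_apply a b c m x h0 h1 h2]
      simp [hexEquiv_inl j, blockDiagonal_apply, ← hanoiTwoLetter_inr_inl (a + b + c)]
    · rw [Matrix.submatrix_apply, hanoiSplit_inr, hanoiSplit_inr,
        hanoiGamma_succ_apply a b c m x h0 h1 h2]
      simp [blockDiagonal_apply, hanoiTwoLetter_inr_inr]
  rw [h, det_fromBlocks_blockDiagonal]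
  simp only [coupling_elimination _ x hx, det_hanoiHex, Finset.prod_const, Finset.card_univ]
  simp [hanoiGamma]

/-! ### The Laplacian of the Schreier graph and the starting point. -/

theorem hanoiEdgeWeight_mk (w : Fin 3 → ℝ) (n : ℕ) {u v : HanoiWord n} :
    hanoiEdgeWeight w n s(u, v) = ∑ s, if hanoiAct s n u = v then w s else 0 := by
  refine Finset.sum_congr rfl fun s _ => ?_
  congr 1
  refine propext ⟨?_, fun h => ⟨u, by rw [h]⟩⟩
  rintro ⟨u', h⟩
  rcases Sym2.eq_iff.1 h with ⟨rfl, rfl⟩ | ⟨rfl, rfl⟩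
  · rfl
  · exact hanoiAct_hanoiAct n s v

theorem hanoiEdgeWeight_of_not_adj (w : Fin 3 → ℝ) (n : ℕ) {u v : HanoiWord n} (huv : u ≠ v)
    (h : ¬ (hanoiSchreier n).Adj u v) : hanoiEdgeWeight w n s(u, v) = 0 := by
  rw [hanoiEdgeWeight_mk]
  refine Finset.sum_eq_zero fun s _ => if_neg fun hs => h ?_
  exact (SimpleGraph.fromRel_adj _ _ _).2 ⟨huv, .inl ⟨s, hs⟩⟩

/-- The Laplacian matrix of the Schreier graph. -/
def hanoiLaplacian (a b c : ℝ) (n : ℕ) : Matrix (HanoiWord n) (HanoiWord n) ℝ :=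
  Matrix.of fun u v => (if u = v then a + b + c else 0) -
    ∑ s, if hanoiAct s n u = v then ![a, b, c] s else 0

/-- Loops may be kept: a generator fixing `v` adds its weight to the diagonal entry a+b+c and is
subtracted again. -/
theorem hanoiT_eq_det (n : ℕ) (a b c : ℝ) :
    hanoiT n a b c = ((hanoiLaplacian a b c n).submatrix
      (Subtype.val : {v : HanoiWord n // v ≠ 0} → _) Subtype.val).det := by
  rw [hanoiT, spanningTreeGF_eq_det' _ _ (fun u v => hanoiEdgeWeight_of_not_adj _ n) 0]
  congr 1
  ext v v'
  simp only [Matrix.of_apply, Matrix.submatrix_apply, hanoiLaplacian, hanoiEdgeWeight_mk,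
    Finset.sum_mul]
  -- For a fixed generator exactly one `u` is the image of `v`, so the total weight at `v` is a+b+c.
  rw [Finset.sum_comm]
  simp only [mul_sub, Finset.sum_sub_distrib, mul_ite, mul_one, mul_zero]
  by_cases h : v = v'
  · simp [h, Fin.sum_univ_three]
  · simp [h, Subtype.val_injective.ne h]

/-- At the starting point the couplings between blocks are the generators changing the first letter.
Only the row and column of the zero word differ from the Laplacian. -/
theorem hanoiGamma_start_apply (a b c : ℝ) (m : ℕ) {i j : Fin 3} {u v : HanoiWord m}
    (hi : i ≠ 0 ∨ u ≠ 0) (hj : j ≠ 0 ∨ v ≠ 0) :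
    hanoiGamma a b c m (hanoiStart a b c) (i, u) (j, v) =
      hanoiLaplacian a b c (m + 1) (Fin.cons i u) (Fin.cons j v) := by
  simp only [hanoiLaplacian, Matrix.of_apply, hanoiAct, Fin.cons_zero, Fin.tail_cons, Fin.cons_inj,
    Fin.sum_univ_three]
  rcases eq_or_ne u v with rfl | huv
  · by_cases hu : u = 0
    · subst hu
      fin_cases i <;> fin_cases j <;>
        simp [hanoiGamma, hanoiG, hanoiLabel, hanoiGenMatrix, hanoiQ, hanoiStart, hanoiPerm,
          blockDiagonal_apply, Equiv.swap_apply_def] at hi hj ⊢ <;> congr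
    · fin_cases i <;> fin_cases j <;>
        simp [hanoiGamma, hanoiG, hanoiLabel, hanoiGenMatrix, hanoiQ, hanoiStart, hanoiPerm,
          blockDiagonal_apply, Equiv.swap_apply_def, hu] <;> congr
  · fin_cases i <;> fin_cases j <;>
      simp [hanoiGamma, hanoiG, hanoiLabel, hanoiGenMatrix, hanoiPerm,
        blockDiagonal_apply, Equiv.swap_apply_def, huv] <;> congr

theorem hanoiAct_two_zero (n : ℕ) : hanoiAct 2 n 0 = 0 := by
  induction n with
  | zero => rfl
  | succ n ih =>
    have h : hanoiPerm 2 0 = 0 := by decide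
    have ht : Fin.tail (0 : HanoiWord (n + 1)) = 0 := rfl
    funext k
    refine Fin.cases ?_ (fun k => ?_) k <;> simp [hanoiAct, h, ht, ih]

theorem hanoiGamma_zero_zero (a b c : ℝ) (m : ℕ) (x : Fin 9 → ℝ) :
    hanoiGamma a b c m x (0, 0) (0, 0) = a + b := by
  simp [hanoiGamma, hanoiG, hanoiLabel, hanoiGenMatrix, hanoiQ, hanoiAct_two_zero]

theorem hanoiGamma_zero_of_ne (a b c : ℝ) (m : ℕ) (x : Fin 9 → ℝ) {j : Fin 3} {v : HanoiWord m}
    (hj : j ≠ 0 ∨ v ≠ 0) : hanoiGamma a b c m x (0, 0) (j, v) = 0 := by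
  rcases eq_or_ne v 0 with rfl | hv
  · fin_cases j <;> simp [hanoiGamma, hanoiG, hanoiQ] at hj ⊢
  · simp [hanoiGamma, hanoiG, hanoiGenMatrix, hanoiLabel, blockDiagonal_apply, hv.symm,
      hanoiAct_two_zero]

/-- The row of the zero word is zero off the diagonal, so its entry a+b splits off and leaves the
reduced Laplacian. -/
theorem det_hanoiGamma_start (a b c : ℝ) (m : ℕ) :
    (hanoiGamma a b c m (hanoiStart a b c)).det = (a + b) * hanoiT (m + 1) a b c := by
  have hne : ∀ {v : HanoiWord (m + 1)}, v ≠ 0 → v 0 ≠ 0 ∨ Fin.tail v ≠ 0 := by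
    intro v hv
    by_contra! h
    refine hv (funext fun k => ?_)
    exact Fin.cases h.1 (fun k => congrFun h.2 k) k
  rw [← Matrix.det_submatrix_equiv_self (Fin.consEquiv fun _ : Fin (m + 1) => Fin 3).symm,
    Matrix.twoBlockTriangular_det _ (fun v : HanoiWord (m + 1) => v ≠ 0), mul_comm]
  · congr 1
    · have : Subsingleton {v : HanoiWord (m + 1) // ¬ v ≠ 0} :=
        ⟨fun u v => Subtype.ext ((not_not.1 u.2).trans (not_not.1 v.2).symm)⟩
      rw [Matrix.det_eq_elem_of_subsingleton (k := ⟨0, by simp⟩)]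
      exact hanoiGamma_zero_zero a b c m _
    · rw [hanoiT_eq_det]
      congr 1
      ext ⟨v, hv⟩ ⟨v', hv'⟩
      change hanoiGamma a b c m _ (v 0, Fin.tail v) (v' 0, Fin.tail v') = _
      rw [hanoiGamma_start_apply a b c m (hne hv) (hne hv'), Fin.cons_self_tail,
        Fin.cons_self_tail]
      rfl
  · intro v hv v' hv'
    rw [not_not] at hv
    subst hv
    exact hanoiGamma_zero_of_ne a b c m _ (hne hv')

/-! ### Iterating the elimination. -/

theorem hanoiOrbit_succ (a b c : ℝ) (k : ℕ) :
    hanoiOrbit a b c (k + 1) = hanoiP (hanoiOrbit a b c k) :=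
  Function.iterate_succ_apply' _ _ _

theorem hanoiOrbit_weights (a b c : ℝ) (k : ℕ) :
    hanoiOrbit a b c k 0 = a ∧ hanoiOrbit a b c k 1 = b ∧ hanoiOrbit a b c k 2 = c := by
  induction k with
  | zero => exact ⟨rfl, rfl, rfl⟩
  | succ k ih =>
    rw [hanoiOrbit_succ]
    exact ih

/-- Elimination number `i`, counted from 0, leaves words of length m+k-1-i, so it removes that power
of 3 of hexagons. -/
theorem det_hanoiGamma_add (a b c : ℝ) (k m : ℕ) (hD : ∀ i < k, hanoiDIter a b c i ≠ 0) :
    (hanoiGamma a b c (m + k) (hanoiStart a b c)).det =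
      (∏ i ∈ Finset.range k, hanoiDIter a b c i ^ 3 ^ (m + k - 1 - i)) *
        (hanoiGamma a b c m (hanoiOrbit a b c k)).det := by
  induction k generalizing m with
  | zero => simp [hanoiOrbit]
  | succ k ih =>
    obtain ⟨h0, h1, h2⟩ := hanoiOrbit_weights a b c k
    rw [show m + (k + 1) = m + 1 + k by omega, ih (m + 1) fun i hi => hD i (by omega),
      det_hanoiGamma_succ a b c m _ h0 h1 h2 (hD k (by omega)), Finset.prod_range_succ,
      ← hanoiOrbit_succ, mul_assoc]
    have h : m + 1 + k - 1 - k = m := by omega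
    rw [h]
    rfl

/-! ### Positivity along the orbit, and the conclusion. -/

/-- The conditions preserved by the rational map for positive weights: the weights are positive
and the row sums of the Laplacian matrix vanish. -/
def IsHanoiPositive (x : Fin 9 → ℝ) : Prop :=
  (0 < x 0 ∧ 0 < x 1 ∧ 0 < x 2 ∧ 0 < x 3 ∧ 0 < x 4 ∧ 0 < x 5) ∧
    x 6 = x 2 + x 3 + x 4 ∧ x 7 = x 1 + x 3 + x 5 ∧ x 8 = x 0 + x 4 + x 5

/-- With zero row sums, D is the reduced Laplacian determinant of the hexagon with its three
neighbours merged into a root. It thus counts weighted trees: after substitution, every monomial has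
a positive coefficient. -/
theorem IsHanoiPositive.den_pos {x : Fin 9 → ℝ} (hx : IsHanoiPositive x) : 0 < hanoiDen x := by
  obtain ⟨⟨h0, h1, h2, h3, h4, h5⟩, h6, h7, h8⟩ := hx
  rw [hanoiDen, hanoiD, h6, h7, h8]
  ring_nf
  positivity

/-- The constant vector stays in the kernel under a Schur complement, so the row sums remain zero.
The numerators of the new couplings again expand with positive coefficients. -/
theorem IsHanoiPositive.hanoiP {x : Fin 9 → ℝ} (hx : IsHanoiPositive x) :
    IsHanoiPositive (hanoiP x) := by
  have hD := hx.den_pos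
  obtain ⟨⟨h0, h1, h2, h3, h4, h5⟩, h6, h7, h8⟩ := hx
  refine ⟨⟨h0, h1, h2, div_pos ?_ hD, div_pos ?_ hD, div_pos ?_ hD⟩, ?_, ?_, ?_⟩
  · rw [hanoiN4, h6, h7, h8]
    ring_nf
    positivity
  · rw [hanoiN5, h6, h7, h8]
    ring_nf
    positivity
  · rw [hanoiN6, h6, h7, h8]
    ring_nf
    positivity
  · change x 6 + _ / hanoiDen x = x 2 + _ / hanoiDen x + _ / hanoiDen x
    field_simp
    rw [hanoiDen, hanoiD, hanoiN7, hanoiN4, hanoiN5, h6, h7, h8]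
    ring
  · change x 7 + _ / hanoiDen x = x 1 + _ / hanoiDen x + _ / hanoiDen x
    field_simp
    rw [hanoiDen, hanoiD, hanoiN8, hanoiN4, hanoiN6, h6, h7, h8]
    ring
  · change x 8 + _ / hanoiDen x = x 0 + _ / hanoiDen x + _ / hanoiDen x
    field_simp
    rw [hanoiDen, hanoiD, hanoiN9, hanoiN5, hanoiN6, h6, h7, h8]
    ring

theorem isHanoiPositive_hanoiOrbit {a b c : ℝ} (ha : 0 < a) (hb : 0 < b) (hc : 0 < c) (k : ℕ) :
    IsHanoiPositive (hanoiOrbit a b c k) := by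
  induction k with
  | zero =>
    refine ⟨⟨ha, hb, hc, ha, hb, hc⟩, ?_, ?_, ?_⟩ <;>
      simp only [hanoiOrbit, Function.iterate_zero, id, hanoiStart, Matrix.cons_val] <;> ring
  | succ k ih =>
    rw [hanoiOrbit_succ]
    exact ih.hanoiP

theorem mainTheorem4 :
    (∀ a b c : ℝ, 0 < a → 0 < b → 0 < c → ∀ k : ℕ, hanoiDIter a b c k ≠ 0) ∧
    (∀ n : ℕ, 3 ≤ n → ∀ a b c : ℝ, a + b ≠ 0 → (∀ k ≤ n - 3, hanoiDIter a b c k ≠ 0) →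
      hanoiT n a b c =
        1 / (a + b) *
          (∏ k ∈ Finset.Icc 0 (n - 3), hanoiDIter a b c k ^ 3 ^ (n - k - 2)) *
          (hanoiLambda a b c 2 (hanoiOrbit a b c (n - 3))).det) := by
  refine ⟨fun a b c ha hb hc k => (isHanoiPositive_hanoiOrbit ha hb hc k).den_pos.ne', ?_⟩
  intro n hn a b c hab hD
  obtain ⟨n, rfl⟩ := Nat.exists_eq_add_of_le' hn
  rw [Nat.add_sub_cancel] at hD ⊢
  -- With `n` now standing for the original n-3, there are n+1 eliminations, down to blocks indexed
  -- by words of length 1; Λ_2 at iterate n is `hanoiGamma` at iterate n+1.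
  have h := det_hanoiGamma_add a b c (n + 1) 1 fun i hi => hD i (by omega)
  rw [show 1 + (n + 1) = n + 2 by omega, det_hanoiGamma_start] at h
  rw [mul_assoc, eq_comm, one_div_mul_eq_div, div_eq_iff hab, mul_comm _ (a + b), h,
    hanoiLambda_eq_hanoiGamma, hanoiOrbit_succ]
  congr 1
  have hI : Finset.Icc 0 n = Finset.range (n + 1) := by
    ext k
    simp
  rw [hI]
  refine Finset.prod_congr rfl fun k hk => ?_
  congr 2
  omega
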